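/- Conventions. A \emph{right Morita ring} is a two-sided artinian ring $R$ such that the injective envelopes of the simple right $R$-modules are finitely generated. Let $\mathrm{Mod}\,R$ be the category of right $R$-modules, $\mathcal S\subseteq \mathrm{Mod}\,R$ a full subcategory closed under arbitrary direct sums and under direct summands, and $\mathcal S_{\mathrm f}=\mathcal S\cap \mathrm{mod}\,R$ its full subcategory of finitely generated modules. Let $\mathcal T$ be $\mathcal S$ or $\mathcal S_{\mathrm f}$. A morphism $g:B\to C$ is \emph{right almost split in $\mathcal T$} if it is not a split epimorphism and every $h:X\to C$ with $X\in\mathcal T$ that is not a split epimorphism factors through $g$; \emph{left almost split in $\mathcal T$} is defined dually. A non-split exact sequence $0\to A\xrightarrow{f}B\xrightarrow{g}C\to0$ with $A,B,C\in \mathcal S_{\mathrm f}$ is an \emph{Auslander--Reiten (AR) sequence in $\mathcal T$} if $f$ is left almost split and $g$ is right almost split in $\mathcal T$. An object $C\in \mathcal S_{\mathrm f}$ is \emph{relatively projective} (\emph{relatively injective}) if every short exact sequence with all terms in $\mathcal S_{\mathrm f}$ that ends (starts) in $C$ splits. A class $\mathcal V$ of indecomposable objects of $\mathcal S_{\mathrm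 f}$ \emph{has AR sequences in $\mathcal T$} if every $M\in\mathcal V$ admits a left almost split morphism $M\to B$ and a right almost split morphism $B'\to M$ in $\mathcal T$ with $B,B'\in \mathcal S_{\mathrm f}$, every $M\in\mathcal V$ that is not relatively projective is the end term of an AR sequence in $\mathcal T$, and every $M\in\mathcal V$ that is not relatively injective is the initial term of one. The category $\mathcal S_{\mathrm f}$ \emph{has AR sequences in $\mathcal T$} if the class of all its indecomposable objects does. The \emph{AR quiver} of $\mathcal S_{\mathrm f}$ has as vertices the isomorphism classes of indecomposable objects of $\mathcal S_{\mathrm f}$, with an arrow $[X]\to[Y]$ whenever there is an irreducible morphism $X\to Y$ in $\mathcal S_{\mathrm f}$; a component is a connected component of the underlying graph. A module is \emph{endofinite} if it has finite length over its endomorphism ring. Proposition. Let $R$ be a right Morita ring and $\mathcal S$ a full subcategory of $\mathrm{Mod}\,R$ closed under direct sums and summands. Let $\Gamma$ be a component of the AR quiver of $\mathcal S_{\mathrm f}$ with finitely many vertices, such that the modules in $\Gamma$ have AR sequences in $\mathcal S_{\mathrm f}$. Suppose that (1) some finite direct sum of modules in $\Gamma$ is a projective generator of $\mathrm{Mod}\,R$;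 (2) every module in $\Gamma$ is endofinite; (3) every AR sequence in $\mathcal S_{\mathrm f}$ whose end terms lie in $\Gamma$ is an AR sequence in $\mathcal S$, and, for every relatively injective $A$ in $\Gamma$, every morphism $A\to B$ with $B\in\mathcal S_{\mathrm f}$ that is left almost split in $\mathcal S_{\mathrm f}$ is left almost split in $\mathcal S$. Then $\mathcal S_{\mathrm f}$ has AR sequences in $\mathcal S$; $\Gamma$ is the whole AR quiver of $\mathcal S_{\mathrm f}$, i.e. every indecomposable object of $\mathcal S_{\mathrm f}$ lies in $\Gamma$; and every object of $\mathcal S$ is a direct sum of (indecomposable) modules in $\Gamma$. -/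

import Mathlib

open CategoryTheory

universe u

namespace RelativeAR

/-! Right `R`-modules are modules over `Rᵐᵒᵖ`; `Mod R` is `ModuleCat.{u} Rᵐᵒᵖ`. -/

section Rings

/-- `i : U → E` is an injective envelope of `U`: `E` is injective, `i` is a monomorphism, and the
image of `i` is an essential submodule of `E`. -/
structure IsInjectiveEnvelope {A : Type u} [Ring A] {U E : Type u} [AddCommGroup U] [Module A U]
    [AddCommGroup E] [Module A E] (i : U →ₗ[A] E) : Prop where
  injective_module : Module.Injective A E
  mono : Function.Injective i
  essential : ∀ N : Submodule A E, N ⊓ LinearMap.range i = ⊥ → N = ⊥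

/-- A right Morita ring: a (two-sided) artinian ring such that the injective envelopes of the
simple right modules are finitely generated. -/
structure IsRightMoritaRing (R : Type u) [Ring R] : Prop where
  artinian_left : IsArtinianRing R
  artinian_right : IsArtinianRing Rᵐᵒᵖ
  finite_envelope : ∀ (U E : Type u) [AddCommGroup U] [Module Rᵐᵒᵖ U] [AddCommGroup E]
    [Module Rᵐᵒᵖ E] (i : U →ₗ[Rᵐᵒᵖ] E), IsSimpleModule Rᵐᵒᵖ U → IsInjectiveEnvelope i →
      Module.Finite Rᵐᵒᵖ E

end Rings

section Modules

variable {A : Type u} [Ring A]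

/-- `M` is endofinite: it has finite length as a module over its endomorphism ring. -/
def IsEndofinite (M : ModuleCat.{u} A) : Prop :=
  IsFiniteLength (Module.End A M) M

/-- Closure under arbitrary (possibly infinite) direct sums. -/
def IsClosedUnderDirectSums (S : ObjectProperty (ModuleCat.{u} A)) : Prop :=
  ∀ (ι : Type u) (M : ι → ModuleCat.{u} A), (∀ i, S (M i)) →
    S (ModuleCat.of A (DirectSum ι fun i => M i))

/-- Closure under direct summands (in particular under isomorphisms). -/
def IsClosedUnderSummands (S : ObjectProperty (ModuleCat.{u} A)) : Prop :=
  ∀ X Y : ModuleCat.{u} A, Nonempty (Retract X Y) → S Y → S X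

/-- The full subcategory `S ∩ mod` of finitely generated modules in `S`. -/
def fgPart (S : ObjectProperty (ModuleCat.{u} A)) : ObjectProperty (ModuleCat.{u} A) :=
  fun M => S M ∧ Module.Finite A M

/-- `g : B ⟶ C` is right almost split with respect to test objects in `S`. -/
def IsRightAlmostSplit (S : ObjectProperty (ModuleCat.{u} A)) {B C : ModuleCat.{u} A}
    (g : B ⟶ C) : Prop :=
  ¬ IsSplitEpi g ∧ ∀ (X : ModuleCat.{u} A) (h : X ⟶ C), S X → ¬ IsSplitEpi h →
    ∃ k : X ⟶ B, k ≫ g = h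

/-- `f : A₀ ⟶ B` is left almost split with respect to test objects in `S`. -/
def IsLeftAlmostSplit (S : ObjectProperty (ModuleCat.{u} A)) {A₀ B : ModuleCat.{u} A}
    (f : A₀ ⟶ B) : Prop :=
  ¬ IsSplitMono f ∧ ∀ (X : ModuleCat.{u} A) (h : A₀ ⟶ X), S X → ¬ IsSplitMono h →
    ∃ k : B ⟶ X, f ≫ k = h

/-- A short exact sequence of modules with all three terms in `F`. -/
structure IsExactIn (F : ObjectProperty (ModuleCat.{u} A)) (E : ShortComplex (ModuleCat.{u} A)) :
    Prop where
  mem₁ : F E.X₁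
  mem₂ : F E.X₂
  mem₃ : F E.X₃
  shortExact : E.ShortExact

/-- A non-split exact sequence with terms in `F` whose maps are left and right almost split in `S`:
an Auslander-Reiten sequence in `S`. -/
structure IsARSequence (F S : ObjectProperty (ModuleCat.{u} A))
    (E : ShortComplex (ModuleCat.{u} A)) : Prop extends IsExactIn F E where
  nonsplit : IsEmpty E.Splitting
  left : IsLeftAlmostSplit S E.f
  right : IsRightAlmostSplit S E.g

/-- `C` is projective relative to `F` (Ext-projective): every exact sequence in `F` ending in `C`
splits. -/
def IsRelProjective (F : ObjectProperty (ModuleCat.{u} A)) (C : ModuleCat.{u} A) : Prop :=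
  ∀ E : ShortComplex (ModuleCat.{u} A), IsExactIn F E →
    Nonempty (E.X₃ ≅ C) → Nonempty E.Splitting

/-- `C` is injective relative to `F` (Ext-injective): every exact sequence in `F` starting in `C`
splits. -/
def IsRelInjective (F : ObjectProperty (ModuleCat.{u} A)) (C : ModuleCat.{u} A) : Prop :=
  ∀ E : ShortComplex (ModuleCat.{u} A), IsExactIn F E →
    Nonempty (E.X₁ ≅ C) → Nonempty E.Splitting

/-- The modules satisfying `V` have left and right almost split morphisms in `S` with objects in
`F`, and those of them that are not relatively projective (injective) have Auslander-Reiten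
sequences in `S` ending (starting) in them, with objects in `F`. -/
structure HaveARSequences (V F S : ObjectProperty (ModuleCat.{u} A)) : Prop where
  leftAlmostSplit : ∀ M, V M → ∃ (B : ModuleCat.{u} A) (f : M ⟶ B), F B ∧ IsLeftAlmostSplit S f
  rightAlmostSplit : ∀ M, V M → ∃ (B : ModuleCat.{u} A) (g : B ⟶ M), F B ∧ IsRightAlmostSplit S g
  ending : ∀ M, V M → ¬ IsRelProjective F M →
    ∃ E : ShortComplex (ModuleCat.{u} A), IsARSequence F S E ∧ Nonempty (E.X₃ ≅ M)
  starting : ∀ M, V M → ¬ IsRelInjective F M →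
    ∃ E : ShortComplex (ModuleCat.{u} A), IsARSequence F S E ∧ Nonempty (E.X₁ ≅ M)

/-- The indecomposable objects of `F`. -/
def indec (F : ObjectProperty (ModuleCat.{u} A)) : ObjectProperty (ModuleCat.{u} A) :=
  fun M => F M ∧ Indecomposable M

/-- `F` has Auslander-Reiten sequences in `S`. -/
def HasARSequencesIn (F S : ObjectProperty (ModuleCat.{u} A)) : Prop :=
  HaveARSequences (indec F) F S

/-- Irreducible morphisms of the full subcategory `F`. -/
structure IsIrreducibleIn (F : ObjectProperty (ModuleCat.{u} A)) {X Y : ModuleCat.{u} A}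
    (f : X ⟶ Y) : Prop where
  not_splitMono : ¬ IsSplitMono f
  not_splitEpi : ¬ IsSplitEpi f
  factor : ∀ (Z : ModuleCat.{u} A) (s : X ⟶ Z) (t : Z ⟶ Y), F Z → s ≫ t = f →
    IsSplitMono s ∨ IsSplitEpi t

/-- Isomorphism of indecomposable objects of `F`. -/
def indecIso (F : ObjectProperty (ModuleCat.{u} A)) : Setoid {M : ModuleCat.{u} A // indec F M} where
  r X Y := Nonempty (X.1 ≅ Y.1)
  iseqv := ⟨fun X => ⟨Iso.refl X.1⟩, fun ⟨e⟩ => ⟨e.symm⟩, fun ⟨e⟩ ⟨e'⟩ => ⟨e.trans e'⟩⟩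

/-- The Auslander-Reiten quiver of `F`: its vertices are the isomorphism classes of indecomposable
objects of `F`. -/
def ARQuiver (F : ObjectProperty (ModuleCat.{u} A)) : Type (u + 1) :=
  Quotient (indecIso F)

/-- The vertex `[M]`. -/
def ARQuiver.vertex {F : ObjectProperty (ModuleCat.{u} A)} (M : ModuleCat.{u} A)
    (hM : indec F M) : ARQuiver F :=
  Quotient.mk (indecIso F) ⟨M, hM⟩

/-- There is an arrow `[X] → [Y]` precisely when there is an irreducible morphism `X → Y` in `F`. -/
instance ARQuiver.quiver (F : ObjectProperty (ModuleCat.{u} A)) : Quiver.{0} (ARQuiver F) where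
  Hom a b := PLift (∃ (X Y : ModuleCat.{u} A) (hX : indec F X) (hY : indec F Y) (f : X ⟶ Y),
    a = ARQuiver.vertex X hX ∧ b = ARQuiver.vertex Y hY ∧ IsIrreducibleIn F f)

/-- A connected component of the Auslander-Reiten quiver of `F`. -/
abbrev ARComponent (F : ObjectProperty (ModuleCat.{u} A)) : Type (u + 1) :=
  Quiver.WeaklyConnectedComponent (ARQuiver F)

/-- The set of vertices of a component. -/
def ARComponent.vertices {F : ObjectProperty (ModuleCat.{u} A)} (Γ : ARComponent F) :
    Set (ARQuiver F) :=
  {v | Quiver.WeaklyConnectedComponent.mk v = Γ}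

/-- The (indecomposable) modules whose isomorphism class is a vertex of `Γ`. -/
def ARComponent.modules {F : ObjectProperty (ModuleCat.{u} A)} (Γ : ARComponent F) :
    ObjectProperty (ModuleCat.{u} A) :=
  fun M => ∃ hM : indec F M, ARQuiver.vertex M hM ∈ Γ.vertices

/-- `Γ` contains a projective generator of the module category: a direct sum of finitely many
modules in `Γ` is projective and a generator. -/
def ARComponent.ContainsProjectiveGenerator {F : ObjectProperty (ModuleCat.{u} A)}
    (Γ : ARComponent F) : Prop :=
  ∃ (n : ℕ) (P : Fin n → ModuleCat.{u} A), (∀ i, Γ.modules (P i)) ∧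
    Module.Projective A (DirectSum (Fin n) fun i => P i) ∧
    IsSeparator (ModuleCat.of A (DirectSum (Fin n) fun i => P i))

end Modules

end RelativeAR

namespace RelativeAR

/-! ### Indecomposable modules, retracts and finite decompositions. -/

section Modules

variable {A : Type u} [Ring A]

open CategoryTheory.Limits

/-! The indecomposable summands of the target of a minimal left almost split map out of a module in
`Γ` receive irreducible maps from it, so they stay in `Γ`. The assumptions on AR sequences and on
relatively injective modules make such maps left almost split against all of `S`, not only against
finitely generated modules.

Given `X` in `S`, choose a maximal independent family of submodules of `X` that lie in `Γ` and whose
finite sums are direct summands of `X`; let `Y` be its sum. If `Y ≠ X`, the generator yields `h : N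
⟶ X` with `N` in `Γ` and `h x ∉ Y`. By maximality `h` agrees modulo `Y` with a map that is not a
split monomorphism (`exists_not_isSplitMono_of_maximal`). That map factors through a left almost
split map, and one of its components again takes a value outside `Y`. Iteration gives arbitrarily
long compositions of non-isomorphisms in `Γ` that do not kill `x`. Lengths in the finite component
`Γ` are bounded, so this contradicts the Harada-Sai lemma (`IsNonIsoComp.eq_zero`).

Hence `X` is a direct sum of modules in `Γ`. An indecomposable `X` is then itself in `Γ`, and right
almost split maps need only be tested on finitely generated summands. -/

theorem _root_.CategoryTheory.Indecomposable.eq_bot_or_eq_bot {M : ModuleCat.{u} A} (hM : Indecomposable M)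
    {p q : Submodule A M} (h : IsCompl p q) : p = ⊥ ∨ q = ⊥ := by
  have e : M ≅ ModuleCat.of A p ⊞ ModuleCat.of A q :=
    (Submodule.prodEquivOfIsCompl p q h).toModuleIso.symm ≪≫
      (ModuleCat.biprodIsoProd (ModuleCat.of A p) (ModuleCat.of A q)).symm
  refine (hM.2 _ _ e).imp (fun h0 => ?_) (fun h0 => ?_)
  all_goals
    rw [ModuleCat.isZero_iff_subsingleton] at h0
    exact Submodule.subsingleton_iff_eq_bot.mp h0

theorem _root_.CategoryTheory.Indecomposable.nontrivial {M : ModuleCat.{u} A} (hM : Indecomposable M) :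
    Nontrivial M := by
  have := hM.1
  rwa [ModuleCat.isZero_iff_subsingleton, not_subsingleton_iff_nontrivial] at this

theorem isIso_of_bijective {M N : ModuleCat.{u} A} (f : M ⟶ N) (h : Function.Bijective f) :
    IsIso f := (ConcreteCategory.isIso_iff_bijective f).mpr h

theorem hom_comp_apply_eq {M N : ModuleCat.{u} A} {s : M ⟶ N} {r : N ⟶ M} (h : s ≫ r = 𝟙 M)
    (x : M) : r (s x) = x := by
  rw [← ModuleCat.comp_apply, h, ModuleCat.id_apply]

/-- Complementary submodules attached to a retract. -/
theorem isCompl_range_ker {M N : ModuleCat.{u} A} {s : M ⟶ N} {r : N ⟶ M} (h : s ≫ r = 𝟙 M) :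
    IsCompl (LinearMap.range s.hom) (LinearMap.ker r.hom) := by
  constructor
  · rw [Submodule.disjoint_def]
    rintro _ ⟨y, rfl⟩ hy
    have h1 : r (s y) = 0 := hy
    rw [hom_comp_apply_eq h] at h1
    simp [h1]
  · rw [codisjoint_iff, eq_top_iff]
    intro x _
    refine Submodule.mem_sup.mpr ⟨s (r x), ⟨r x, rfl⟩, x - s (r x), ?_, by abel⟩
    rw [LinearMap.mem_ker, map_sub]
    exact sub_eq_zero.mpr (hom_comp_apply_eq h (r x)).symm

theorem _root_.CategoryTheory.Indecomposable.isIso_of_retract {M N : ModuleCat.{u} A} (hN : Indecomposable N)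
    (hM : ¬ IsZero M) {s : M ⟶ N} {r : N ⟶ M} (h : s ≫ r = 𝟙 M) : IsIso s ∧ IsIso r := by
  have hc := isCompl_range_ker h
  have hs : IsIso s := by
    rcases hN.eq_bot_or_eq_bot hc with h0 | h0
    · exfalso
      apply hM
      rw [IsZero.iff_id_eq_zero, ← h]
      have : s = 0 := by
        ext x
        have : s x ∈ LinearMap.range s.hom := ⟨x, rfl⟩
        rw [h0] at this
        simpa using this
      simp [this]
    · apply isIso_of_bijective
      refine ⟨Function.LeftInverse.injective (hom_comp_apply_eq h), ?_⟩
      have h1 := hc.sup_eq_top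
      rw [h0, sup_bot_eq] at h1
      exact LinearMap.range_eq_top.mp h1
  refine ⟨hs, ?_⟩
  have : r = inv s := by rw [← cancel_epi s, h, IsIso.hom_inv_id]
  rw [this]; infer_instance

theorem _root_.CategoryTheory.Indecomposable.isIso_of_isSplitEpi {M N : ModuleCat.{u} A} (hN : Indecomposable N)
    (hM : ¬ IsZero M) (r : N ⟶ M) [IsSplitEpi r] : IsIso r :=
  (hN.isIso_of_retract hM (IsSplitEpi.id r)).2

theorem _root_.CategoryTheory.Indecomposable.isIso_of_isSplitMono {M N : ModuleCat.{u} A} (hN : Indecomposable N)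
    (hM : ¬ IsZero M) (s : M ⟶ N) [IsSplitMono s] : IsIso s :=
  (hN.isIso_of_retract hM (IsSplitMono.id s)).1

theorem _root_.CategoryTheory.Indecomposable.of_iso {M N : ModuleCat.{u} A} (hM : Indecomposable M) (e : M ≅ N) :
    Indecomposable N :=
  ⟨fun h => hM.1 (h.of_iso e), fun Y Z i => hM.2 Y Z (e ≪≫ i)⟩

variable {S : ObjectProperty (ModuleCat.{u} A)}

theorem fgPart_of_retract (hS : IsClosedUnderSummands S) {X Y : ModuleCat.{u} A}
    {s : X ⟶ Y} {r : Y ⟶ X} (h : s ≫ r = 𝟙 X) (hY : fgPart S Y) : fgPart S X := by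
  refine ⟨hS X Y ⟨⟨s, r, h⟩⟩ hY.1, ?_⟩
  have := hY.2
  exact Module.Finite.of_surjective r.hom
    (Function.RightInverse.surjective (hom_comp_apply_eq h))

theorem indec_of_iso (hS : IsClosedUnderSummands S) {X Y : ModuleCat.{u} A} (e : X ≅ Y)
    (hX : indec (fgPart S) X) : indec (fgPart S) Y :=
  ⟨fgPart_of_retract hS e.inv_hom_id hX.1, hX.2.of_iso e⟩

theorem length_lt_of_retract [IsArtinianRing A] {X Y : ModuleCat.{u} A} [Module.Finite A Y]
    {s : X ⟶ Y} {r : Y ⟶ X} (h : s ≫ r = 𝟙 X) (hs : ¬ IsIso s) :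
    Module.length A X < Module.length A Y := by
  have hinj : Function.Injective s := Function.LeftInverse.injective (hom_comp_apply_eq h)
  rw [(LinearEquiv.ofInjective s.hom hinj).length_eq]
  apply Submodule.length_lt
  intro h1
  exact hs (isIso_of_bijective s ⟨hinj, LinearMap.range_eq_top.mp h1⟩)

/-- A module is expressed as a finite sum of retracts with the property `V`. -/
def IsFiniteSumOf (V : ObjectProperty (ModuleCat.{u} A)) (M : ModuleCat.{u} A) : Prop :=
  ∃ (ι : Type) (_ : Fintype ι) (B : ι → ModuleCat.{u} A) (s : ∀ i, B i ⟶ M) (r : ∀ i, M ⟶ B i),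
    (∀ i, V (B i)) ∧ (∀ i, s i ≫ r i = 𝟙 (B i)) ∧ ∑ i, r i ≫ s i = 𝟙 M

theorem isFiniteSumOf_indec [IsArtinianRing A] (hS : IsClosedUnderSummands S)
    (M : ModuleCat.{u} A) (hM : fgPart S M) : IsFiniteSumOf (indec (fgPart S)) M := by
  induction hl : Module.length A M using WellFoundedLT.induction generalizing M with
  | ind l ih =>
  subst hl
  by_cases h0 : IsZero M
  · exact ⟨Empty, inferInstance, fun i => i.elim, fun i => i.elim, fun i => i.elim,
      fun i => i.elim, fun i => i.elim, h0.eq_of_src _ _⟩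
  by_cases hi : Indecomposable M
  · exact ⟨Unit, inferInstance, fun _ => M, fun _ => 𝟙 M, fun _ => 𝟙 M, fun _ => ⟨hM, hi⟩,
      fun _ => by simp, by simp⟩
  have : ∃ (Y Z : ModuleCat.{u} A) (_ : M ≅ Y ⊞ Z), ¬ IsZero Y ∧ ¬ IsZero Z := by
    by_contra! hcon
    exact hi ⟨h0, fun Y Z e => or_iff_not_imp_left.mpr (hcon Y Z e)⟩
  obtain ⟨Y, Z, e, hY, hZ⟩ := this
  have := hM.2
  have hYr : (biprod.inl ≫ e.inv) ≫ (e.hom ≫ biprod.fst) = 𝟙 Y := by simp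
  have hZr : (biprod.inr ≫ e.inv) ≫ (e.hom ≫ biprod.snd) = 𝟙 Z := by simp
  have hYZ : (e.hom ≫ biprod.fst) ≫ (biprod.inl ≫ e.inv) +
      (e.hom ≫ biprod.snd) ≫ (biprod.inr ≫ e.inv) = 𝟙 M := by
    have h1 : e.hom ≫ (biprod.fst ≫ biprod.inl + biprod.snd ≫ biprod.inr) ≫ e.inv = 𝟙 M := by
      rw [biprod.total, Category.id_comp, e.hom_inv_id]
    simpa only [Preadditive.comp_add, Preadditive.add_comp, Category.assoc] using h1
  have hYi : ¬ IsIso (biprod.inl ≫ e.inv : Y ⟶ M) := by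
    intro h
    apply hZ
    rw [IsZero.iff_id_eq_zero, ← hZr]
    have h1 : (biprod.inl ≫ e.inv : Y ⟶ M) ≫ (e.hom ≫ biprod.snd) = 0 := by simp
    have h2 : e.hom ≫ (biprod.snd : Y ⊞ Z ⟶ Z) = 0 := by
      rw [← cancel_epi (biprod.inl ≫ e.inv : Y ⟶ M), h1, comp_zero]
    rw [h2, comp_zero]
  have hZi : ¬ IsIso (biprod.inr ≫ e.inv : Z ⟶ M) := by
    intro h
    apply hY
    rw [IsZero.iff_id_eq_zero, ← hYr]
    have h1 : (biprod.inr ≫ e.inv : Z ⟶ M) ≫ (e.hom ≫ biprod.fst) = 0 := by simp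
    have h2 : e.hom ≫ (biprod.fst : Y ⊞ Z ⟶ Y) = 0 := by
      rw [← cancel_epi (biprod.inr ≫ e.inv : Z ⟶ M), h1, comp_zero]
    rw [h2, comp_zero]
  obtain ⟨ι₁, _, B₁, s₁, r₁, hB₁, hr₁, ht₁⟩ :=
    ih _ (length_lt_of_retract hYr hYi) Y (fgPart_of_retract hS hYr hM) rfl
  obtain ⟨ι₂, _, B₂, s₂, r₂, hB₂, hr₂, ht₂⟩ :=
    ih _ (length_lt_of_retract hZr hZi) Z (fgPart_of_retract hS hZr hM) rfl
  refine ⟨ι₁ ⊕ ι₂, inferInstance, Sum.rec B₁ B₂,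
    Sum.rec (fun i => s₁ i ≫ (biprod.inl ≫ e.inv)) (fun i => s₂ i ≫ (biprod.inr ≫ e.inv)),
    Sum.rec (fun i => (e.hom ≫ biprod.fst) ≫ r₁ i) (fun i => (e.hom ≫ biprod.snd) ≫ r₂ i),
    ?_, ?_, ?_⟩
  · rintro (i | i)
    exacts [hB₁ i, hB₂ i]
  · rintro (i | i)
    · simp [hr₁]
    · simp [hr₂]
  · rw [Fintype.sum_sum_type, ← hYZ]
    congr 1
    · have := congrArg (fun t => (e.hom ≫ biprod.fst) ≫ t ≫ (biprod.inl ≫ e.inv)) ht₁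
      simpa only [Preadditive.comp_sum, Preadditive.sum_comp, Category.id_comp,
        Category.assoc] using this
    · have := congrArg (fun t => (e.hom ≫ biprod.snd) ≫ t ≫ (biprod.inr ≫ e.inv)) ht₂
      simpa only [Preadditive.comp_sum, Preadditive.sum_comp, Category.id_comp,
        Category.assoc] using this

end Modules

/-! ### Minimal almost split maps and irreducible maps. -/

section AlmostSplit

open CategoryTheory.Limits

variable {A : Type u} [Ring A] {S : ObjectProperty (ModuleCat.{u} A)}

/-- Every endomorphism of the target that fixes `f` is an isomorphism. -/
def IsLeftMinimal {M B : ModuleCat.{u} A} (f : M ⟶ B) : Prop :=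
  ∀ φ : B ⟶ B, f ≫ φ = f → IsIso φ

/-- Every endomorphism of the source that fixes `g` is an isomorphism. -/
def IsRightMinimal {B M : ModuleCat.{u} A} (g : B ⟶ M) : Prop :=
  ∀ φ : B ⟶ B, φ ≫ g = g → IsIso φ

/-- The Fitting decomposition, as a retract through which every map fixed by `φ` factors. -/
theorem exists_fitting_retract {B : ModuleCat.{u} A} [IsNoetherian A B] [IsArtinian A B]
    (φ : B ⟶ B) : ∃ (K : ModuleCat.{u} A) (s : K ⟶ B) (r : B ⟶ K), s ≫ r = 𝟙 K ∧
      (∀ (M : ModuleCat.{u} A) (f : M ⟶ B), f ≫ φ = f → f ≫ r ≫ s = f) ∧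
      (IsIso s → IsIso φ) := by
  obtain ⟨n, hn⟩ := Filter.eventually_atTop.mp
    (LinearMap.eventually_isCompl_ker_pow_range_pow (R := A) φ.hom)
  -- The exponent is taken positive so that the range of the power lies in the range of `φ`; this
  -- gives surjectivity of `φ` in the last part.
  have hc := (hn (n + 1) (by omega)).symm
  refine ⟨ModuleCat.of A (LinearMap.range (φ.hom ^ (n + 1))),
    ModuleCat.ofHom (Submodule.subtype _), ModuleCat.ofHom (Submodule.projectionOnto _ _ hc),
    ?_, ?_, ?_⟩
  · ext x
    exact congrArg _ (Submodule.projectionOnto_apply_left hc x)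
  · intro M f hf
    ext x
    have hpow : ∀ m : ℕ, (φ.hom ^ m) (f x) = f x := by
      intro m
      induction m with
      | zero => rfl
      | succ m ih =>
        rw [pow_succ', Module.End.mul_apply, ih]
        exact congrArg (fun t => t.hom x) hf
    have hx : f x ∈ LinearMap.range (φ.hom ^ (n + 1)) := ⟨f x, hpow _⟩
    exact congrArg Subtype.val (Submodule.projectionOnto_apply_left hc ⟨f x, hx⟩)
  · intro hs
    have htop : LinearMap.range (φ.hom ^ (n + 1)) = ⊤ := by
      rw [eq_top_iff]
      intro x _
      obtain ⟨y, rfl⟩ := ((ConcreteCategory.isIso_iff_bijective _).mp hs).2 x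
      exact y.2
    have hsurj : Function.Surjective φ.hom := by
      rw [← LinearMap.range_eq_top, eq_top_iff, ← htop, pow_succ']
      exact LinearMap.range_comp_le_range _ _
    exact isIso_of_bijective φ ⟨IsNoetherian.injective_of_surjective_endomorphism _ hsurj, hsurj⟩

/-- If `φ` fixes `f` without being invertible, `f` factors through the Fitting summand of `φ`, which
is strictly shorter than `B`; corestricting to it preserves almost splitness, so induction on length
applies. -/
theorem IsLeftAlmostSplit.exists_minimal [IsArtinianRing A] (hS : IsClosedUnderSummands S)
    {M B : ModuleCat.{u} A} {f : M ⟶ B} (hB : fgPart S B) (hf : IsLeftAlmostSplit S f) :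
    ∃ (B' : ModuleCat.{u} A) (f' : M ⟶ B'), fgPart S B' ∧ IsLeftAlmostSplit S f' ∧
      IsLeftMinimal f' := by
  induction hl : Module.length A B using WellFoundedLT.induction generalizing B with
  | ind l ih =>
  subst hl
  by_cases hmin : IsLeftMinimal f
  · exact ⟨B, f, hB, hf, hmin⟩
  have := hB.2
  unfold IsLeftMinimal at hmin
  push Not at hmin
  obtain ⟨φ, hφ, hφi⟩ := hmin
  obtain ⟨K, s, r, hsr, hfac, hiso⟩ := exists_fitting_retract φ
  refine ih _ (length_lt_of_retract hsr (fun h => hφi (hiso h))) (f := f ≫ r)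
    (fgPart_of_retract hS hsr hB) ⟨?_, ?_⟩ rfl
  · intro h
    exact hf.1 (IsSplitMono.mk' ⟨r ≫ retraction (f ≫ r), by
      rw [← Category.assoc]; exact IsSplitMono.id (f ≫ r)⟩)
  · intro X h hX hh
    obtain ⟨k, hk⟩ := hf.2 X h hX hh
    refine ⟨s ≫ k, ?_⟩
    rw [← hk, Category.assoc, ← Category.assoc r, ← Category.assoc f, hfac _ _ hφ]

/-- If `f ≫ r = a ≫ b` and `a` is not a split monomorphism, then `a = f ≫ k`. Replacing the
component `r` of the identity of `B` by `k ≫ b` gives an endomorphism that fixes `f`; by minimality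
it is invertible, which splits `b`. -/
theorem isIrreducibleIn_comp_of_left {M B C : ModuleCat.{u} A} {f : M ⟶ B}
    (hM : Indecomposable M) (hf : IsLeftAlmostSplit S f) (hmin : IsLeftMinimal f)
    (hC : Indecomposable C) {s : C ⟶ B} {r : B ⟶ C} (hsr : s ≫ r = 𝟙 C) :
    IsIrreducibleIn (fgPart S) (f ≫ r) := by
  have hmono : ¬ IsSplitMono (f ≫ r) := fun h =>
    hf.1 (IsSplitMono.mk' ⟨r ≫ retraction (f ≫ r), by
      rw [← Category.assoc]; exact IsSplitMono.id (f ≫ r)⟩)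
  refine ⟨hmono, fun h => hmono ?_, ?_⟩
  · have := hM.isIso_of_isSplitEpi hC.1 (f ≫ r)
    infer_instance
  · intro Z a b hZ hab
    by_cases ha : IsSplitMono a
    · exact Or.inl ha
    obtain ⟨k, hk⟩ := hf.2 Z a hZ.1 ha
    right
    have hfix : f ≫ (𝟙 B - (r - k ≫ b) ≫ s) = f := by
      have : f ≫ k ≫ b = f ≫ r := by rw [← Category.assoc, hk, hab]
      simp [Preadditive.comp_sub, Preadditive.sub_comp, reassoc_of% this]
    have hiso := hmin _ hfix
    have hr : (𝟙 B - (r - k ≫ b) ≫ s) ≫ r = k ≫ b := by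
      simp [Preadditive.sub_comp, hsr]
    obtain ⟨ψ, -, hψ⟩ := hiso.out
    exact IsSplitEpi.mk' ⟨s ≫ ψ ≫ k, by
      rw [Category.assoc, Category.assoc, ← hr, reassoc_of% hψ, hsr]⟩

theorem isIrreducibleIn_comp_of_right {M B C : ModuleCat.{u} A} {g : B ⟶ M}
    (hM : Indecomposable M) (hg : IsRightAlmostSplit S g) (hmin : IsRightMinimal g)
    (hC : Indecomposable C) {s : C ⟶ B} {r : B ⟶ C} (hsr : s ≫ r = 𝟙 C) :
    IsIrreducibleIn (fgPart S) (s ≫ g) := by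
  have hepi : ¬ IsSplitEpi (s ≫ g) := fun h =>
    hg.1 (IsSplitEpi.mk' ⟨section_ (s ≫ g) ≫ s, by
      rw [Category.assoc]; exact IsSplitEpi.id (s ≫ g)⟩)
  refine ⟨fun h => hepi ?_, hepi, ?_⟩
  · have := hM.isIso_of_isSplitMono hC.1 (s ≫ g)
    infer_instance
  · intro Z a b hZ hab
    by_cases hb : IsSplitEpi b
    · exact Or.inr hb
    obtain ⟨k, hk⟩ := hg.2 Z b hZ.1 hb
    left
    have hfix : (𝟙 B - r ≫ (s - a ≫ k)) ≫ g = g := by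
      simp [Preadditive.comp_sub, Preadditive.sub_comp, hk, hab]
    have hiso := hmin _ hfix
    have hr : s ≫ (𝟙 B - r ≫ (s - a ≫ k)) = a ≫ k := by
      simp [Preadditive.comp_sub, reassoc_of% hsr]
    obtain ⟨ψ, hψ, -⟩ := hiso.out
    exact IsSplitMono.mk' ⟨k ≫ ψ ≫ r, by
      rw [← Category.assoc, ← hr, Category.assoc, reassoc_of% hψ, hsr]⟩

/-- The inclusions of two nonzero complementary summands are not split epimorphisms, so both lift
through `g`, and the lifts add up to a section of `g`. -/
theorem IsRightAlmostSplit.indecomposable (hS : IsClosedUnderSummands S)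
    {B C : ModuleCat.{u} A} {g : B ⟶ C} (hC : fgPart S C)
    (hg : IsRightAlmostSplit (fgPart S) g) : Indecomposable C := by
  refine ⟨fun h => hg.1 (IsSplitEpi.mk' ⟨0, h.eq_of_src _ _⟩), fun Y Z e => ?_⟩
  by_contra! hYZ
  have hYr : (biprod.inl ≫ e.inv) ≫ (e.hom ≫ biprod.fst) = 𝟙 Y := by simp
  have hZr : (biprod.inr ≫ e.inv) ≫ (e.hom ≫ biprod.snd) = 𝟙 Z := by simp
  have hYn : ¬ IsSplitEpi (biprod.inl ≫ e.inv : Y ⟶ C) := by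
    intro h
    apply hYZ.2
    rw [IsZero.iff_id_eq_zero, ← hZr]
    have h1 : (biprod.inl ≫ e.inv : Y ⟶ C) ≫ (e.hom ≫ biprod.snd) = 0 := by simp
    have h2 : e.hom ≫ (biprod.snd : Y ⊞ Z ⟶ Z) = 0 := by
      rw [← cancel_epi (biprod.inl ≫ e.inv : Y ⟶ C), h1, comp_zero]
    rw [h2, comp_zero]
  have hZn : ¬ IsSplitEpi (biprod.inr ≫ e.inv : Z ⟶ C) := by
    intro h
    apply hYZ.1
    rw [IsZero.iff_id_eq_zero, ← hYr]
    have h1 : (biprod.inr ≫ e.inv : Z ⟶ C) ≫ (e.hom ≫ biprod.fst) = 0 := by simp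
    have h2 : e.hom ≫ (biprod.fst : Y ⊞ Z ⟶ Y) = 0 := by
      rw [← cancel_epi (biprod.inr ≫ e.inv : Z ⟶ C), h1, comp_zero]
    rw [h2, comp_zero]
  obtain ⟨k, hk⟩ := hg.2 Y _ (fgPart_of_retract hS hYr hC) hYn
  obtain ⟨l, hl⟩ := hg.2 Z _ (fgPart_of_retract hS hZr hC) hZn
  refine hg.1 (IsSplitEpi.mk' ⟨e.hom ≫ (biprod.fst ≫ k + biprod.snd ≫ l), ?_⟩)
  have h1 : e.hom ≫ (biprod.fst ≫ biprod.inl + biprod.snd ≫ biprod.inr) ≫ e.inv = 𝟙 C := by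
    rw [biprod.total, Category.id_comp, e.hom_inv_id]
  rw [← h1]
  simp only [Category.assoc, Preadditive.add_comp, hk, hl]

theorem IsLeftAlmostSplit.indecomposable (hS : IsClosedUnderSummands S)
    {B C : ModuleCat.{u} A} {f : C ⟶ B} (hC : fgPart S C)
    (hf : IsLeftAlmostSplit (fgPart S) f) : Indecomposable C := by
  refine ⟨fun h => hf.1 (IsSplitMono.mk' ⟨0, h.eq_of_src _ _⟩), fun Y Z e => ?_⟩
  by_contra! hYZ
  have hYr : (biprod.inl ≫ e.inv) ≫ (e.hom ≫ biprod.fst) = 𝟙 Y := by simp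
  have hZr : (biprod.inr ≫ e.inv) ≫ (e.hom ≫ biprod.snd) = 𝟙 Z := by simp
  have hYn : ¬ IsSplitMono (e.hom ≫ biprod.fst : C ⟶ Y) := by
    intro h
    apply hYZ.2
    rw [IsZero.iff_id_eq_zero, ← hZr]
    have h1 : (biprod.inr ≫ e.inv) ≫ (e.hom ≫ biprod.fst : C ⟶ Y) = 0 := by simp
    have h2 : (biprod.inr : Z ⟶ Y ⊞ Z) ≫ e.inv = 0 := by
      rw [← cancel_mono (e.hom ≫ biprod.fst : C ⟶ Y), h1, zero_comp]
    rw [h2, zero_comp]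
  have hZn : ¬ IsSplitMono (e.hom ≫ biprod.snd : C ⟶ Z) := by
    intro h
    apply hYZ.1
    rw [IsZero.iff_id_eq_zero, ← hYr]
    have h1 : (biprod.inl ≫ e.inv) ≫ (e.hom ≫ biprod.snd : C ⟶ Z) = 0 := by simp
    have h2 : (biprod.inl : Y ⟶ Y ⊞ Z) ≫ e.inv = 0 := by
      rw [← cancel_mono (e.hom ≫ biprod.snd : C ⟶ Z), h1, zero_comp]
    rw [h2, zero_comp]
  obtain ⟨k, hk⟩ := hf.2 Y _ (fgPart_of_retract hS hYr hC) hYn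
  obtain ⟨l, hl⟩ := hf.2 Z _ (fgPart_of_retract hS hZr hC) hZn
  refine hf.1 (IsSplitMono.mk' ⟨k ≫ biprod.inl ≫ e.inv + l ≫ biprod.inr ≫ e.inv, ?_⟩)
  have h1 : e.hom ≫ (biprod.fst ≫ biprod.inl + biprod.snd ≫ biprod.inr) ≫ e.inv = 𝟙 C := by
    rw [biprod.total, Category.id_comp, e.hom_inv_id]
  rw [← h1]
  simp only [Category.assoc, Preadditive.add_comp, Preadditive.comp_add, reassoc_of% hk,
    reassoc_of% hl]

variable {F : ObjectProperty (ModuleCat.{u} A)} {E : ShortComplex (ModuleCat.{u} A)}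

/-- An endomorphism `φ` fixing `f` induces `ψ` on the end term. If `ψ` were not invertible it would
lift to `k` through `g`; then `φ - g ≫ k` would factor through `f` and yield a retraction of `f`. So
`ψ` is invertible, and the five lemma applies. -/
theorem IsARSequence.isLeftMinimal (hE : IsARSequence F S E) (hS : S E.X₃)
    (h₃ : Indecomposable E.X₃) : IsLeftMinimal E.f := by
  intro φ hφ
  have := hE.shortExact.mono_f
  have := hE.shortExact.epi_g
  have hfg : E.f ≫ (φ ≫ E.g) = 0 := by rw [reassoc_of% hφ, E.zero]
  have hψ : E.g ≫ hE.shortExact.exact.desc (φ ≫ E.g) hfg = φ ≫ E.g :=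
    hE.shortExact.exact.g_desc _ _
  set ψ := hE.shortExact.exact.desc (φ ≫ E.g) hfg
  have hψi : IsIso ψ := by
    by_contra hni
    have hns : ¬ IsSplitEpi ψ := fun h => hni (h₃.isIso_of_isSplitEpi h₃.1 ψ)
    obtain ⟨k, hk⟩ := hE.right.2 _ ψ hS hns
    have h0 : (φ - E.g ≫ k) ≫ E.g = 0 := by
      rw [Preadditive.sub_comp, Category.assoc, hk, hψ, sub_self]
    have hl : hE.shortExact.exact.lift (φ - E.g ≫ k) h0 ≫ E.f = φ - E.g ≫ k :=
      hE.shortExact.exact.lift_f _ _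
    refine hE.left.1 (IsSplitMono.mk' ⟨hE.shortExact.exact.lift (φ - E.g ≫ k) h0, ?_⟩)
    rw [← cancel_mono E.f, Category.assoc, hl, Preadditive.comp_sub, hφ, E.zero_assoc, zero_comp,
      sub_zero, Category.id_comp]
  let α : E ⟶ E := ⟨𝟙 _, φ, ψ, by simp [hφ], hψ.symm⟩
  have h1 : IsIso α.τ₁ := by change IsIso (𝟙 _); infer_instance
  have h3 : IsIso α.τ₃ := hψi
  exact ShortComplex.isIso₂_of_shortExact_of_isIso₁₃ α hE.shortExact hE.shortExact

theorem IsARSequence.isRightMinimal (hE : IsARSequence F S E) (hS : S E.X₁)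
    (h₁ : Indecomposable E.X₁) : IsRightMinimal E.g := by
  intro φ hφ
  have := hE.shortExact.mono_f
  have := hE.shortExact.epi_g
  have hfg : (E.f ≫ φ) ≫ E.g = 0 := by rw [Category.assoc, hφ, E.zero]
  have hψ : hE.shortExact.exact.lift (E.f ≫ φ) hfg ≫ E.f = E.f ≫ φ :=
    hE.shortExact.exact.lift_f _ _
  set ψ := hE.shortExact.exact.lift (E.f ≫ φ) hfg
  have hψi : IsIso ψ := by
    by_contra hni
    have hns : ¬ IsSplitMono ψ := fun h => hni (h₁.isIso_of_isSplitMono h₁.1 ψ)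
    obtain ⟨k, hk⟩ := hE.left.2 _ ψ hS hns
    have h0 : E.f ≫ (φ - k ≫ E.f) = 0 := by
      rw [Preadditive.comp_sub, reassoc_of% hk, hψ, sub_self]
    have hl : E.g ≫ hE.shortExact.exact.desc (φ - k ≫ E.f) h0 = φ - k ≫ E.f :=
      hE.shortExact.exact.g_desc _ _
    refine hE.right.1 (IsSplitEpi.mk' ⟨hE.shortExact.exact.desc (φ - k ≫ E.f) h0, ?_⟩)
    rw [← cancel_epi E.g, reassoc_of% hl, Preadditive.sub_comp, hφ, Category.assoc, E.zero,
      comp_zero, sub_zero, Category.comp_id]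
  let α : E ⟶ E := ⟨ψ, φ, 𝟙 _, hψ, by simp [hφ]⟩
  have h1 : IsIso α.τ₁ := hψi
  have h3 : IsIso α.τ₃ := by change IsIso (𝟙 _); infer_instance
  exact ShortComplex.isIso₂_of_shortExact_of_isIso₁₃ α hE.shortExact hE.shortExact

end AlmostSplit

/-! ### The Harada-Sai lemma. -/

section HaradaSai

variable {A : Type u} [Ring A]

/-- Morphisms that contain a composition of `n` non-isomorphisms between objects of `V`. -/
def IsNonIsoComp (V : ObjectProperty (ModuleCat.{u} A)) :
    ℕ → ∀ {M N : ModuleCat.{u} A}, (M ⟶ N) → Prop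
  | 0, M, N, _ => V M ∧ V N
  | n + 1, M, N, h => V M ∧ ∃ (K : ModuleCat.{u} A) (f : M ⟶ K) (g : K ⟶ N),
      ¬ IsIso f ∧ IsNonIsoComp V n g ∧ f ≫ g = h

variable {V : ObjectProperty (ModuleCat.{u} A)}

theorem IsNonIsoComp.source {n : ℕ} {M N : ModuleCat.{u} A} {h : M ⟶ N}
    (hh : IsNonIsoComp V n h) : V M := by
  cases n <;> exact hh.1

theorem IsNonIsoComp.target {n : ℕ} {M N : ModuleCat.{u} A} {h : M ⟶ N}
    (hh : IsNonIsoComp V n h) : V N := by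
  induction n generalizing M with
  | zero => exact hh.2
  | succ n ih =>
    obtain ⟨_, K, f, g, _, hg, _⟩ := hh
    exact ih hg

theorem IsNonIsoComp.split {m n : ℕ} {M N : ModuleCat.{u} A} {h : M ⟶ N}
    (hh : IsNonIsoComp V (m + 1 + n) h) : ∃ (K L : ModuleCat.{u} A) (f : M ⟶ K) (g : K ⟶ L)
      (h' : L ⟶ N), IsNonIsoComp V m f ∧ ¬ IsIso g ∧ IsNonIsoComp V n h' ∧ f ≫ g ≫ h' = h := by
  induction m generalizing M with
  | zero =>
    rw [zero_add, add_comm] at hh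
    obtain ⟨hM, K, f, g, hf, hg, rfl⟩ := hh
    exact ⟨M, K, 𝟙 M, f, g, ⟨hM, hM⟩, hf, hg, by simp⟩
  | succ m ih =>
    rw [show m + 1 + 1 + n = (m + 1 + n) + 1 by omega] at hh
    obtain ⟨hM, K, f, g, hf, hg, rfl⟩ := hh
    obtain ⟨K', L, f', g', h', hf', hg', hh', rfl⟩ := ih hg
    exact ⟨K', L, f ≫ f', g', h', ⟨hM, K, f, f', hf, hf', rfl⟩, hg', hh', by simp⟩

theorem submodule_eq_of_le_of_length_le {X : Type u} [AddCommGroup X] [Module A X]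
    [IsNoetherian A X] [IsArtinian A X] {p q : Submodule A X} (hpq : p ≤ q)
    (h : Module.length A q ≤ Module.length A p) : p = q := by
  by_contra hne
  have := Submodule.height_strictMono (lt_of_le_of_ne hpq hne)
  rw [← Module.length_submodule, ← Module.length_submodule] at this
  exact absurd h (not_le.mpr this)

theorem injective_of_length_range_ge {X Y : Type u} [AddCommGroup X] [Module A X]
    [AddCommGroup Y] [Module A Y] [IsNoetherian A X] [IsArtinian A X] (f : X →ₗ[A] Y)
    (h : Module.length A X ≤ Module.length A (LinearMap.range f)) : Function.Injective f := by
  have h1 := Module.length_eq_add_of_exact (LinearMap.ker f).subtype f.rangeRestrict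
    (Submodule.subtype_injective _) f.surjective_rangeRestrict (by
      rw [LinearMap.exact_iff, LinearMap.ker_rangeRestrict, Submodule.range_subtype])
  have hfin : Module.length A (LinearMap.range f) ≠ ⊤ := by
    intro h2
    rw [h2] at h1
    exact (Module.length_ne_top (R := A) (M := X)) (by rw [h1]; simp)
  have h3 : Module.length A (LinearMap.ker f) = 0 := by
    rw [h1] at h
    by_contra h0
    exact h0 (nonpos_iff_eq_zero.mp ((ENat.add_le_add_iff_right hfin).mp (by rwa [zero_add])))
  rw [Module.length_eq_zero_iff, Submodule.subsingleton_iff_eq_bot] at h3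
  exact LinearMap.ker_eq_bot.mp h3

/-- If the images of `f` and `h` are not longer than that of `f ≫ g ≫ h ≠ 0`, then `g` is an
isomorphism. -/
theorem isIso_of_length_range_le [IsArtinianRing A] {M K L N : ModuleCat.{u} A}
    [Module.Finite A M] [Module.Finite A N]
    (hK : Indecomposable K) (hL : Indecomposable L) (f : M ⟶ K) (g : K ⟶ L) (h : L ⟶ N)
    (hf : Module.length A (LinearMap.range f.hom) ≤
      Module.length A (LinearMap.range (f ≫ g ≫ h).hom))
    (hh : Module.length A (LinearMap.range h.hom) ≤
      Module.length A (LinearMap.range (f ≫ g ≫ h).hom))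
    (h0 : f ≫ g ≫ h ≠ 0) : IsIso g := by
  have hr : LinearMap.range (f ≫ g ≫ h).hom = LinearMap.range h.hom := by
    refine submodule_eq_of_le_of_length_le ?_ hh
    rintro _ ⟨x, rfl⟩
    exact ⟨g (f x), rfl⟩
  have hinj : ∀ x, h (g (f x)) = 0 → f x = 0 := by
    let t : LinearMap.range f.hom →ₗ[A] N := (g ≫ h).hom ∘ₗ (LinearMap.range f.hom).subtype
    have ht : LinearMap.range t = LinearMap.range (f ≫ g ≫ h).hom := by
      ext y
      constructor
      · rintro ⟨⟨_, x, rfl⟩, rfl⟩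
        exact ⟨x, rfl⟩
      · rintro ⟨x, rfl⟩
        exact ⟨⟨_, x, rfl⟩, rfl⟩
    have htinj : Function.Injective t := injective_of_length_range_ge t (by rw [ht]; exact hf)
    intro x hx
    have : (⟨f x, x, rfl⟩ : LinearMap.range f.hom) = 0 := htinj (by rw [map_zero]; exact hx)
    exact congrArg Subtype.val this
  have hne : ∃ x, h (g (f x)) ≠ 0 := by
    by_contra! hcon
    exact h0 (by ext x; exact hcon x)
  obtain ⟨x₀, hx₀⟩ := hne
  have hlift : ∀ y : L, ∃ x, h (g (f x)) = h y := by
    intro y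
    have : h y ∈ LinearMap.range (f ≫ g ≫ h).hom := by rw [hr]; exact ⟨y, rfl⟩
    exact this
  -- The length bounds make `g ≫ h` injective on the image of `f`, with the same image as `h`. This
  -- splits both `K` and `L`, and indecomposability kills the kernels.
  have c1 : IsCompl (LinearMap.range f.hom) (LinearMap.ker (g ≫ h).hom) := by
    constructor
    · rw [Submodule.disjoint_def]
      rintro _ ⟨x, rfl⟩ hx
      exact hinj x hx
    · rw [codisjoint_iff, eq_top_iff]
      intro z _
      obtain ⟨x, hx⟩ := hlift (g z)
      refine Submodule.mem_sup.mpr ⟨f x, ⟨x, rfl⟩, z - f x, ?_, by abel⟩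
      rw [LinearMap.mem_ker, map_sub]
      exact sub_eq_zero.mpr hx.symm
  have c2 : IsCompl (LinearMap.range (f ≫ g).hom) (LinearMap.ker h.hom) := by
    constructor
    · rw [Submodule.disjoint_def]
      rintro _ ⟨x, rfl⟩ hx
      have : f x = 0 := hinj x hx
      change g (f x) = 0
      rw [this, map_zero]
    · rw [codisjoint_iff, eq_top_iff]
      intro z _
      obtain ⟨x, hx⟩ := hlift z
      refine Submodule.mem_sup.mpr ⟨g (f x), ⟨x, rfl⟩, z - g (f x), ?_, by abel⟩
      rw [LinearMap.mem_ker, map_sub]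
      exact sub_eq_zero.mpr hx.symm
  apply isIso_of_bijective
  constructor
  · rcases hK.eq_bot_or_eq_bot c1 with hb | hb
    · exfalso
      have : f x₀ ∈ LinearMap.range f.hom := ⟨x₀, rfl⟩
      rw [hb, Submodule.mem_bot] at this
      rw [this, map_zero, map_zero] at hx₀
      exact hx₀ rfl
    · have : Function.Injective (g ≫ h).hom := LinearMap.ker_eq_bot.mp hb
      exact Function.Injective.of_comp (f := h) this
  · rcases hL.eq_bot_or_eq_bot c2 with hb | hb
    · exfalso
      have : g (f x₀) ∈ LinearMap.range (f ≫ g).hom := ⟨x₀, rfl⟩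
      rw [hb, Submodule.mem_bot] at this
      rw [this, map_zero] at hx₀
      exact hx₀ rfl
    · have h1 := c2.sup_eq_top
      rw [hb, sup_bot_eq] at h1
      intro y
      have : y ∈ LinearMap.range (f ≫ g).hom := by rw [h1]; trivial
      obtain ⟨x, hx⟩ := this
      exact ⟨f x, hx⟩

/-- The Harada-Sai lemma. -/
theorem IsNonIsoComp.length_range_add_le [IsArtinianRing A]
    (hV : ∀ M, V M → Indecomposable M ∧ Module.Finite A M) {b : ℕ}
    (hb : ∀ M, V M → Module.length A M ≤ b) (k : ℕ) {M N : ModuleCat.{u} A} {h : M ⟶ N}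
    (hh : IsNonIsoComp V (2 ^ k - 1) h) (h0 : h ≠ 0) :
    Module.length A (LinearMap.range h.hom) + k ≤ b := by
  induction k generalizing M N with
  | zero =>
    rw [Nat.cast_zero, add_zero]
    exact (Module.length_le_of_surjective _ h.hom.surjective_rangeRestrict).trans (hb M hh.source)
  | succ k ih =>
    have hpos : 0 < 2 ^ k := by positivity
    -- Cut the chain at its middle non-isomorphism `g`, leaving `2 ^ k - 1` non-isomorphisms on each
    -- side.
    rw [show 2 ^ (k + 1) - 1 = (2 ^ k - 1) + 1 + (2 ^ k - 1) by rw [pow_succ]; omega] at hh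
    have hM := (hV _ hh.source).2
    have hN := (hV _ hh.target).2
    obtain ⟨K, L, f, g, h', hf, hg, hh', rfl⟩ := hh.split
    have hf1 := ih hf (by rintro rfl; simp at h0)
    have hh1 := ih hh' (by rintro rfl; simp at h0)
    by_contra hcon
    apply hg
    have hfinN : Module.length A N ≠ ⊤ := Module.length_ne_top
    have hlen : Module.length A (LinearMap.range (f ≫ g ≫ h').hom) ≠ ⊤ := fun h1 => hfinN
      (top_le_iff.mp (h1 ▸ Module.length_le_of_injective _ (Submodule.subtype_injective _)))
    obtain ⟨r, hr⟩ := ENat.ne_top_iff_exists.mp hlen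
    rw [← hr] at hcon
    have hcon' : b < r + (k + 1) := by
      push Not at hcon
      exact_mod_cast hcon
    -- If the bound fails for `k + 1`, the composite's image has length more than `b - (k + 1)`,
    -- whereas each half has image of length at most `b - k`. So neither half has a longer image
    -- than the composite, which forces `g` to be invertible.
    have key : ∀ l : ℕ∞, l + k ≤ b → l ≤ r := by
      intro l hl
      have hl' : l ≠ ⊤ := by rintro rfl; simp at hl
      obtain ⟨l, rfl⟩ := ENat.ne_top_iff_exists.mp hl'
      have : l + k ≤ b := by exact_mod_cast hl
      exact_mod_cast (by omega : l ≤ r)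
    refine isIso_of_length_range_le (hV _ hf.target).1 (hV _ hh'.source).1 f g h' ?_ ?_ h0
    · rw [← hr]; exact key _ hf1
    · rw [← hr]; exact key _ hh1

/-- For `k = b + 1` the bound on the image of a nonzero composite reads `length + b + 1 ≤ b`. -/
theorem IsNonIsoComp.eq_zero [IsArtinianRing A]
    (hV : ∀ M, V M → Indecomposable M ∧ Module.Finite A M) {b : ℕ}
    (hb : ∀ M, V M → Module.length A M ≤ b) {M N : ModuleCat.{u} A} {h : M ⟶ N}
    (hh : IsNonIsoComp V (2 ^ (b + 1) - 1) h) : h = 0 := by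
  by_contra h0
  have h1 := hh.length_range_add_le hV hb (b + 1) h0
  have h2 : ((b + 1 : ℕ) : ℕ∞) ≤ b := le_add_self.trans h1
  have : b + 1 ≤ b := by exact_mod_cast h2
  omega

end HaradaSai

/-! ### Maximal locally split families of submodules. -/

section Decomposition

variable {A : Type u} [Ring A]

/-- A linearly independent family of submodules in `V` whose finite sums are direct summands. -/
structure IsLocallySplit (V : ObjectProperty (ModuleCat.{u} A)) {X : Type u} [AddCommGroup X]
    [Module A X] (T : Set (Submodule A X)) : Prop where
  mem : ∀ W ∈ T, V (ModuleCat.of A W)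
  indep : sSupIndep T
  compl : ∀ F ⊆ T, F.Finite → ∃ C, IsCompl (sSup F) C

variable {V : ObjectProperty (ModuleCat.{u} A)}

/-- Each defining condition concerns single members or finite subfamilies, so it passes to unions of
chains and Zorn's lemma applies. -/
theorem IsLocallySplit.exists_maximal (X : Type u) [AddCommGroup X] [Module A X] :
    ∃ T : Set (Submodule A X), Maximal (IsLocallySplit V) T := by
  have hempty : IsLocallySplit V (∅ : Set (Submodule A X)) :=
    ⟨fun _ h => h.elim, sSupIndep_empty, fun F hF _ => ⟨⊤, by
      rw [Set.subset_empty_iff.mp hF, sSup_empty]; exact isCompl_bot_top⟩⟩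
  refine zorn_subset {T | IsLocallySplit V T} fun c hc hchain => ?_
  rcases c.eq_empty_or_nonempty with rfl | hne
  · exact ⟨∅, hempty, fun _ h => h.elim⟩
  refine ⟨⋃₀ c, ⟨?_, ?_, ?_⟩, fun _ h => Set.subset_sUnion_of_mem h⟩
  · rintro W ⟨T, hT, hW⟩
    exact (hc hT).mem W hW
  · rw [sSupIndep_iff_finite]
    intro t ht
    obtain ⟨T, hT, htT⟩ := hchain.directedOn.exists_mem_subset_of_finset_subset_biUnion hne
      (f := fun T => T) (s := t) (by rwa [← Set.sUnion_eq_biUnion])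
    exact (hc hT).indep.mono htT
  · intro F hF hfin
    obtain ⟨T, hT, hFT⟩ := hchain.directedOn.exists_mem_subset_of_finite_of_subset_sUnion hne
      hfin hF
    exact (hc hT).compl F hFT hfin

/-- It suffices that each finite partial sum lies in some complement of `W`, which may vary with the
partial sum, since independence and splitting are both tested on finite subfamilies. -/
theorem IsLocallySplit.insert {X : Type u} [AddCommGroup X] [Module A X]
    {T : Set (Submodule A X)} (hT : IsLocallySplit V T) {W : Submodule A X}
    (hW : V (ModuleCat.of A W))
    (hF : ∀ F ⊆ T, F.Finite → ∃ K, IsCompl W K ∧ sSup F ≤ K) :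
    IsLocallySplit V (Set.insert W T) := by
  have hdisj : Disjoint W (sSup T) := by
    rw [Submodule.disjoint_def]
    intro x hx hxT
    obtain ⟨s, hs, hxs⟩ := Submodule.mem_sSup_iff_exists_finset.mp hxT
    obtain ⟨K, hK, hle⟩ := hF s hs s.finite_toSet
    refine Submodule.disjoint_def.mp hK.disjoint x hx (hle ?_)
    rwa [sSup_eq_iSup]
  refine ⟨?_, ?_, ?_⟩
  · rintro W' (rfl | h)
    exacts [hW, hT.mem W' h]
  · intro a ha
    rcases ha with rfl | ha
    · refine hdisj.mono_right (sSup_le ?_)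
      rintro b ⟨rfl | hb, hne⟩
      · exact absurd rfl hne
      · exact le_sSup hb
    · have h1 : Disjoint a (sSup (T \ {a})) := hT.indep ha
      have h2 : Disjoint (a ⊔ sSup (T \ {a})) W :=
        (hdisj.mono_right (sup_le (le_sSup ha) (sSup_le_sSup Set.sdiff_subset))).symm
      refine (h1.disjoint_sup_right_of_disjoint_sup_left h2).mono_right (sSup_le ?_)
      rintro b ⟨rfl | hb, hne⟩
      · exact le_sup_right
      · exact (le_sSup ⟨hb, hne⟩ : b ≤ sSup (T \ {a})).trans le_sup_left
  · intro F hFi hfin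
    have hsub : F \ {W} ⊆ T := by
      rintro b ⟨hb, hne⟩
      exact (hFi hb).resolve_left hne
    obtain ⟨C, hC⟩ := hT.compl _ hsub hfin.sdiff
    by_cases hWF : W ∈ F
    · obtain ⟨K, hK, hle⟩ := hF _ hsub hfin.sdiff
      have hsup : sSup F = W ⊔ sSup (F \ {W}) := by
        rw [← sSup_insert, Set.insert_sdiff_singleton, Set.insert_eq_of_mem hWF]
      -- By the modular law `C ⊓ K` complements the partial sum inside `K`, hence complements `W ⊔
      -- sSup (F \ {W})` in `X`.
      have hKdec : K = sSup (F \ {W}) ⊔ C ⊓ K := by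
        rw [← sup_inf_assoc_of_le _ hle, hC.sup_eq_top, top_inf_eq]
      refine ⟨C ⊓ K, ?_, ?_⟩
      · rw [hsup]
        refine Disjoint.disjoint_sup_left_of_disjoint_sup_right
          (hC.disjoint.mono_right inf_le_left) ?_
        rw [← hKdec]
        exact hK.disjoint
      · rw [codisjoint_iff, hsup, sup_assoc, ← hKdec, hK.sup_eq_top]
    · rw [Set.sdiff_singleton_eq_self hWF] at hC
      exact ⟨C, hC⟩

/-- Modulo a maximal locally split family, every map from an object of `V` is not a split
monomorphism. -/
theorem exists_not_isSplitMono_of_maximal {X : ModuleCat.{u} A} {T : Set (Submodule A X)}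
    (hT : Maximal (IsLocallySplit V) T) (hiso : ∀ M N, (M ≅ N) → V M → V N)
    {N : ModuleCat.{u} A} (hN : V N) (hN0 : Nontrivial N) (h : N ⟶ X) :
    ∃ h' : N ⟶ X, ¬ IsSplitMono h' ∧ ∀ x, h x - h' x ∈ sSup T := by
  by_contra! hcon
  -- Projecting away from `sSup F` changes `h` only by values in `sSup T`, so the projected map is
  -- still a split monomorphism by `hcon`; its retraction gives a `p` that kills `sSup F`.
  have key : ∀ F ⊆ T, F.Finite → ∃ p : X ⟶ N, h ≫ p = 𝟙 N ∧ sSup F ≤ LinearMap.ker p.hom := by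
    intro F hF hfin
    obtain ⟨C, hC⟩ := hT.prop.compl F hF hfin
    let e : X ⟶ X := ModuleCat.ofHom (C.subtype ∘ₗ Submodule.projectionOnto C (sSup F) hC.symm)
    have heF : ∀ x ∈ sSup F, e x = 0 := fun x hx =>
      congrArg Subtype.val (Submodule.projectionOnto_apply_right hC.symm ⟨x, hx⟩)
    have hsub : ∀ x, x - e x ∈ sSup F := by
      intro x
      have : Submodule.projectionOnto C (sSup F) hC.symm (x - e x) = 0 := by
        rw [map_sub, sub_eq_zero]
        exact (Submodule.projectionOnto_apply_left hC.symm _).symm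
      rwa [Submodule.projectionOnto_apply_eq_zero_iff] at this
    by_cases hs : IsSplitMono (h ≫ e)
    · refine ⟨e ≫ retraction (h ≫ e), ?_, ?_⟩
      · rw [← Category.assoc]
        exact IsSplitMono.id (h ≫ e)
      · intro x hx
        change retraction (h ≫ e) (e x) = 0
        rw [heF x hx, map_zero]
    · obtain ⟨x, hx⟩ := hcon (h ≫ e) hs
      exact absurd (sSup_le_sSup hF (hsub (h x))) hx
  obtain ⟨p₀, hp₀, -⟩ := key ∅ (Set.empty_subset _) Set.finite_empty
  have hinj : Function.Injective h.hom :=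
    Function.LeftInverse.injective (hom_comp_apply_eq hp₀)
  have hW : V (ModuleCat.of A (LinearMap.range h.hom)) :=
    hiso _ _ (LinearEquiv.ofInjective h.hom hinj).toModuleIso hN
  have hins := hT.prop.insert hW fun F hF hfin => by
    obtain ⟨p, hp, hle⟩ := key F hF hfin
    exact ⟨LinearMap.ker p.hom, isCompl_range_ker hp, hle⟩
  -- By maximality the image of `h` is already in the family, so `h` is congruent to `0` modulo
  -- `sSup T`; but `0` is not a split monomorphism out of a nonzero module.
  have hmem : LinearMap.range h.hom ∈ T :=
    hT.le_of_ge hins (Set.subset_insert _ _) (Set.mem_insert _ _)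
  have hzero : ¬ IsSplitMono (0 : N ⟶ X) := by
    intro hs
    obtain ⟨x, hx⟩ := exists_ne (0 : N)
    have h1 := IsSplitMono.id (0 : N ⟶ X)
    rw [Limits.zero_comp] at h1
    exact hx (by simpa using (congrArg (fun t => t.hom x) h1).symm)
  obtain ⟨x, hx⟩ := hcon 0 hzero
  refine hx ?_
  have : h x ∈ sSup T := le_sSup hmem ⟨x, rfl⟩
  simpa using this

variable {S : ObjectProperty (ModuleCat.{u} A)}

/-- Correcting `h` modulo `sSup T` lets it factor through a left almost split map. Were every
component to send `x` into `sSup T`, so would their sum; a surviving component extends the chain by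
one non-isomorphism. -/
theorem exists_isNonIsoComp_of_maximal {X : ModuleCat.{u} A} (hX : S X)
    {T : Set (Submodule A X)}
    (hT : Maximal (IsLocallySplit V) T) (hiso : ∀ M N, (M ≅ N) → V M → V N)
    (hV : ∀ M, V M → Indecomposable M)
    (hlas : ∀ M, V M → ∃ (B : ModuleCat.{u} A) (f : M ⟶ B), IsFiniteSumOf V B ∧
      IsLeftAlmostSplit S f)
    (n : ℕ) {N : ModuleCat.{u} A} (hN : V N) (h : N ⟶ X) (x : N) (hx : h x ∉ sSup T) :
    ∃ (N' : ModuleCat.{u} A) (r : N ⟶ N') (h' : N' ⟶ X), IsNonIsoComp V n r ∧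
      h' (r x) ∉ sSup T := by
  induction n generalizing N with
  | zero => exact ⟨N, 𝟙 N, h, ⟨hN, hN⟩, by simpa using hx⟩
  | succ n ih =>
    obtain ⟨h₁, hs, hh₁⟩ := exists_not_isSplitMono_of_maximal hT hiso hN (hV N hN).nontrivial h
    obtain ⟨B, f, ⟨ι, _, C, s, r, hC, hsr, htot⟩, hf⟩ := hlas N hN
    obtain ⟨k, hk⟩ := hf.2 X h₁ hX hs
    have hx₁ : h₁ x ∉ sSup T := fun hm => hx (by
      have := add_mem (hh₁ x) hm
      simpa using this)
    have : ∃ i, (s i ≫ k) ((f ≫ r i) x) ∉ sSup T := by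
      by_contra! hall
      apply hx₁
      have h2 : h₁ = ∑ i, (f ≫ r i) ≫ (s i ≫ k) := by
        rw [← hk]
        have h3 : f ≫ (∑ i, r i ≫ s i) ≫ k = f ≫ k := by rw [htot, Category.id_comp]
        rw [← h3]
        simp only [Preadditive.sum_comp, Preadditive.comp_sum, Category.assoc]
      have h4 : h₁ x = ∑ i, (s i ≫ k) ((f ≫ r i) x) := by
        have h5 := congrArg (fun t => t.hom x) h2
        simp only [ModuleCat.hom_sum, LinearMap.sum_apply] at h5
        exact h5
      rw [h4]
      exact sum_mem fun i _ => hall i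
    obtain ⟨i, hi⟩ := this
    obtain ⟨N', r', h', hr', hh'⟩ := ih (hC i) (s i ≫ k) _ hi
    refine ⟨N', (f ≫ r i) ≫ r', h', ⟨hN, C i, f ≫ r i, r', fun hiso => hf.1 ?_, hr', rfl⟩, hh'⟩
    exact IsSplitMono.mk' ⟨r i ≫ inv (f ≫ r i), by
      rw [← Category.assoc, IsIso.hom_inv_id]⟩

theorem exists_indep_sSup_eq_top [IsArtinianRing A]
    (hiso : ∀ M N, (M ≅ N) → V M → V N)
    (hV : ∀ M, V M → Indecomposable M ∧ Module.Finite A M) {b : ℕ}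
    (hb : ∀ M, V M → Module.length A M ≤ b)
    (hlas : ∀ M, V M → ∃ (B : ModuleCat.{u} A) (f : M ⟶ B), IsFiniteSumOf V B ∧
      IsLeftAlmostSplit S f)
    (hgen : ∀ (X : ModuleCat.{u} A) (Y : Submodule A X), Y ≠ ⊤ →
      ∃ (N : ModuleCat.{u} A) (h : N ⟶ X) (x : N), V N ∧ h x ∉ Y)
    (X : ModuleCat.{u} A) (hX : S X) :
    ∃ T : Set (Submodule A X), (∀ W ∈ T, V (ModuleCat.of A W)) ∧ sSupIndep T ∧ sSup T = ⊤ := by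
  obtain ⟨T, hT⟩ := IsLocallySplit.exists_maximal (V := V) X
  refine ⟨T, hT.prop.mem, hT.prop.indep, ?_⟩
  by_contra hne
  obtain ⟨N, h, x, hN, hx⟩ := hgen X _ hne
  obtain ⟨N', r, h', hr, hx'⟩ := exists_isNonIsoComp_of_maximal hX hT hiso (fun M hM => (hV M hM).1)
    hlas (2 ^ (b + 1) - 1) hN h x hx
  rw [hr.eq_zero hV hb] at hx'
  exact hx' (by simp)

theorem exists_directSum_equiv {X : Type u} [AddCommGroup X] [Module A X]
    {T : Set (Submodule A X)} (h : sSupIndep T) (htop : sSup T = ⊤) :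
    Nonempty (X ≃ₗ[A] DirectSum T fun W => (W : Submodule A X)) := by
  classical
  have hint : DirectSum.IsInternal (fun W : T => (W : Submodule A X)) :=
    DirectSum.isInternal_submodule_of_iSupIndep_of_iSup_eq_top (sSupIndep_iff T |>.mp h)
      (by rw [← sSup_eq_iSup', htop])
  exact ⟨(LinearEquiv.ofBijective (DirectSum.coeLinearMap _) hint).symm⟩

end Decomposition

/-! ### Components of the AR quiver and their modules. -/

section Component

variable {A : Type u} [Ring A] {S : ObjectProperty (ModuleCat.{u} A)}
  {Γ : ARComponent (fgPart S)}

theorem ARComponent.modules_of_iso (hS : IsClosedUnderSummands S) {M N : ModuleCat.{u} A}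
    (e : M ≅ N) (hM : Γ.modules M) : Γ.modules N := by
  obtain ⟨hi, hv⟩ := hM
  refine ⟨indec_of_iso hS e hi, ?_⟩
  have : ARQuiver.vertex N (indec_of_iso hS e hi) = ARQuiver.vertex M hi :=
    Quotient.sound ⟨e.symm⟩
  rwa [this]

theorem ARComponent.modules_of_irreducible {M N : ModuleCat.{u} A} {f : M ⟶ N}
    (hf : IsIrreducibleIn (fgPart S) f) (hN : indec (fgPart S) N) (hM : Γ.modules M) :
    Γ.modules N := by
  obtain ⟨hi, hv⟩ := hM
  refine ⟨hN, ?_⟩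
  have hv' : Quiver.WeaklyConnectedComponent.mk (ARQuiver.vertex M hi) = Γ := hv
  change Quiver.WeaklyConnectedComponent.mk (ARQuiver.vertex N hN) = Γ
  rw [← hv', Quiver.WeaklyConnectedComponent.eq]
  have a : ARQuiver.vertex M hi ⟶ ARQuiver.vertex N hN := ⟨M, N, hi, hN, f, rfl, rfl, hf⟩
  exact ⟨Quiver.Path.reverse (V := Quiver.Symmetrify (ARQuiver (fgPart S)))
    (Quiver.Hom.toPath (Sum.inl a))⟩

theorem ARComponent.isFiniteSumOf_of_left [IsArtinianRing A] (hS : IsClosedUnderSummands S)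
    {M B : ModuleCat.{u} A} {f : M ⟶ B}
    (hM : Γ.modules M) (hB : fgPart S B) (hf : IsLeftAlmostSplit S f) (hmin : IsLeftMinimal f) :
    IsFiniteSumOf Γ.modules B := by
  obtain ⟨ι, hι, C, s, r, hC, hsr, htot⟩ := isFiniteSumOf_indec hS B hB
  refine ⟨ι, hι, C, s, r, fun i => ?_, hsr, htot⟩
  exact modules_of_irreducible
    (isIrreducibleIn_comp_of_left hM.1.2 hf hmin (hC i).2 (hsr i)) (hC i) hM

/-- A component that contains the initial term of an Auslander-Reiten sequence contains its end
term. -/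
theorem ARComponent.modules_X₃ [IsArtinianRing A] (hS : IsClosedUnderSummands S)
    {E : ShortComplex (ModuleCat.{u} A)} (hE : IsARSequence (fgPart S) (fgPart S) E)
    (h₁ : Γ.modules E.X₁) : Γ.modules E.X₃ := by
  have h₃ : Indecomposable E.X₃ := hE.right.indecomposable hS hE.mem₃
  have hlmin := hE.isLeftMinimal hE.mem₃ h₃
  have hrmin := hE.isRightMinimal hE.mem₁ h₁.1.2
  obtain ⟨ι, _, C, s, r, hC, hsr, htot⟩ := isFiniteSumOf_indec hS E.X₂ hE.mem₂
  -- The end term is reached through a summand of the middle term, which is nonzero because it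
  -- contains the nonzero `E.X₁`.
  have hne : Nonempty ι := by
    by_contra hemp
    rw [not_nonempty_iff] at hemp
    rw [Finset.univ_eq_empty, Finset.sum_empty] at htot
    have := hE.shortExact.mono_f
    refine h₁.1.2.1 ?_
    rw [Limits.IsZero.iff_id_eq_zero, ← cancel_mono E.f, Limits.zero_comp, ← Category.comp_id E.f,
      ← htot, Limits.comp_zero, Limits.comp_zero]
  obtain ⟨i⟩ := hne
  have hi : Γ.modules (C i) := by
    have h := isIrreducibleIn_comp_of_left (S := fgPart S) h₁.1.2 hE.left hlmin (hC i).2 (hsr i)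
    -- Irreducibility was obtained in `fgPart (fgPart S)`, whose objects are those of `fgPart S`.
    exact modules_of_irreducible ⟨h.1, h.2, fun Z a b hZ => h.3 Z a b ⟨hZ, hZ.2⟩⟩ (hC i) h₁
  have h := isIrreducibleIn_comp_of_right (S := fgPart S) h₃ hE.right hrmin (hC i).2 (hsr i)
  exact modules_of_irreducible ⟨h.1, h.2, fun Z a b hZ => h.3 Z a b ⟨hZ, hZ.2⟩⟩ ⟨hE.mem₃, h₃⟩ hi

theorem IsLeftAlmostSplit.of_iso {M N B : ModuleCat.{u} A} {f : M ⟶ B}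
    (hf : IsLeftAlmostSplit S f) (e : N ≅ M) : IsLeftAlmostSplit S (e.hom ≫ f) := by
  refine ⟨fun h => hf.1 (IsSplitMono.mk' ⟨retraction (e.hom ≫ f) ≫ e.hom, ?_⟩), ?_⟩
  · have h1 := IsSplitMono.id (e.hom ≫ f)
    rw [← cancel_epi e.hom, Category.comp_id]
    have h2 := congrArg (fun t => t ≫ e.hom) h1
    simpa only [Category.assoc, Category.id_comp] using h2
  · intro X h hX hh
    obtain ⟨k, hk⟩ := hf.2 X (e.inv ≫ h) hX (fun hs => hh (IsSplitMono.mk'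
      ⟨retraction (e.inv ≫ h) ≫ e.inv, by
        have h1 := IsSplitMono.id (e.inv ≫ h)
        rw [← cancel_epi e.inv, Category.comp_id]
        have h2 := congrArg (fun t => t ≫ e.inv) h1
        simpa only [Category.assoc, Category.id_comp] using h2⟩))
    exact ⟨k, by rw [Category.assoc, hk, e.hom_inv_id_assoc]⟩

theorem ARComponent.exists_length_le [IsArtinianRing A] (hfinite : Γ.vertices.Finite) :
    ∃ b : ℕ, ∀ M, Γ.modules M → Module.length A M ≤ b := by
  let ℓ : ARQuiver (fgPart S) → ℕ∞ := Quotient.lift (fun M => Module.length A M.1)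
    (fun M N ⟨e⟩ => e.toLinearEquiv.length_eq)
  have hℓ : ∀ v, ℓ v ≠ ⊤ := by
    intro v
    induction v using Quotient.inductionOn with
    | h M =>
      have := M.2.1.2
      exact Module.length_ne_top
  obtain ⟨b, hb⟩ := (hfinite.image fun v => (ℓ v).toNat).bddAbove
  refine ⟨b, fun M ⟨hM, hv⟩ => ?_⟩
  have h1 : (ℓ (ARQuiver.vertex M hM)).toNat ≤ b := hb ⟨_, hv, rfl⟩
  have h2 : ℓ (ARQuiver.vertex M hM) = Module.length A M := rfl
  rw [← h2, ← ENat.natCast_toNat (hℓ (ARQuiver.vertex M hM))]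
  exact_mod_cast h1

/-- If all maps from modules in `Γ` landed in `Y`, the separator could not distinguish the quotient
map `X → X/Y` from zero. -/
theorem ARComponent.ContainsProjectiveGenerator.exists_notMem
    (hgen : Γ.ContainsProjectiveGenerator) (X : ModuleCat.{u} A) (Y : Submodule A X)
    (hY : Y ≠ ⊤) : ∃ (N : ModuleCat.{u} A) (h : N ⟶ X) (x : N), Γ.modules N ∧ h x ∉ Y := by
  obtain ⟨n, P, hP, -, hsep⟩ := hgen
  by_contra! hcon
  apply hY
  have h0 : ModuleCat.ofHom Y.mkQ = 0 := by
    refine (isSeparator_def _).mp hsep _ _ fun h => ?_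
    rw [Limits.comp_zero]
    refine ModuleCat.hom_ext (DirectSum.linearMap_ext A fun i => LinearMap.ext fun y => ?_)
    change Y.mkQ (h (DirectSum.lof A (Fin n) (fun i => P i) i y)) = 0
    rw [Submodule.mkQ_apply, Submodule.Quotient.mk_eq_zero]
    exact hcon (P i) (ModuleCat.ofHom (DirectSum.lof A (Fin n) (fun i => P i) i) ≫ h) y (hP i)
  rw [← Submodule.ker_mkQ Y, LinearMap.ker_eq_top]
  exact congrArg ModuleCat.Hom.hom h0

/-- An indecomposable module is isomorphic to a member of every decomposition into nonzero
submodules. -/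
theorem exists_iso_of_indep {X : ModuleCat.{u} A} (hX : Indecomposable X)
    {T : Set (Submodule A X)} (hT : sSupIndep T) (htop : sSup T = ⊤) (hbot : ∀ W ∈ T, W ≠ ⊥) :
    ∃ W ∈ T, Nonempty (ModuleCat.of A W ≅ X) := by
  have hne : T.Nonempty := by
    rw [Set.nonempty_iff_ne_empty]
    rintro rfl
    rw [sSup_empty] at htop
    have := hX.nontrivial
    exact bot_ne_top htop
  obtain ⟨W, hW⟩ := hne
  refine ⟨W, hW, ?_⟩
  have hc : IsCompl W (sSup (T \ {W})) := by
    refine ⟨hT hW, ?_⟩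
    rw [codisjoint_iff, ← sSup_insert, Set.insert_sdiff_singleton, Set.insert_eq_of_mem hW, htop]
  have hb := (hX.eq_bot_or_eq_bot hc).resolve_left (hbot W hW)
  have hWtop : W = ⊤ := by simpa [hb] using hc.sup_eq_top
  subst hWtop
  exact ⟨Submodule.topEquiv.toModuleIso⟩

/-- If the objects of `S` are direct sums of modules in `F`, then right almost split morphisms
in `F` are right almost split in `S`. -/
theorem IsRightAlmostSplit.of_directSum {F : ObjectProperty (ModuleCat.{u} A)}
    {B M : ModuleCat.{u} A} {g : B ⟶ M} (hg : IsRightAlmostSplit F g)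
    (hF : ∀ X, S X → ∃ (ι : Type u) (N : ι → ModuleCat.{u} A), (∀ i, F (N i)) ∧
        Nonempty (X ≃ₗ[A] DirectSum ι fun i => N i)) :
    IsRightAlmostSplit S g := by
  classical
  refine ⟨hg.1, fun X h hX hh => ?_⟩
  obtain ⟨ι, N, hN, ⟨e⟩⟩ := hF X hX
  let j : ∀ i, N i ⟶ X := fun i =>
    ModuleCat.ofHom (e.symm.toLinearMap ∘ₗ DirectSum.lof A ι (fun i => N i) i)
  -- A section of the restriction of `h` to a summand would be a section of `h`, so each restriction
  -- lifts separately and the lifts assemble.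
  have hj : ∀ i, ∃ k : N i ⟶ B, k ≫ g = j i ≫ h := by
    intro i
    refine hg.2 _ _ (hN i) fun hs => hh (IsSplitEpi.mk' ⟨section_ (j i ≫ h) ≫ j i, ?_⟩)
    rw [Category.assoc]
    exact IsSplitEpi.id (j i ≫ h)
  choose k hk using hj
  refine ⟨ModuleCat.ofHom (DirectSum.toModule A ι B (fun i => (k i).hom) ∘ₗ e.toLinearMap), ?_⟩
  have hlin : g.hom ∘ₗ DirectSum.toModule A ι B (fun i => (k i).hom) =
      h.hom ∘ₗ e.symm.toLinearMap := by
    refine DirectSum.linearMap_ext A fun i => ?_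
    ext y
    rw [LinearMap.comp_apply, LinearMap.comp_apply, DirectSum.toModule_lof]
    exact congrArg (fun t => t.hom y) (hk i)
  ext x
  have := LinearMap.congr_fun hlin (e x)
  simpa using this

end Component

end RelativeAR

/-! ### The proposition. -/

open RelativeAR in
theorem proposition2 (R : Type u) [Ring R] (hR : RelativeAR.IsRightMoritaRing R)
    (S : ObjectProperty (ModuleCat.{u} Rᵐᵒᵖ))
    (hsum : RelativeAR.IsClosedUnderDirectSums S)
    (hsummand : RelativeAR.IsClosedUnderSummands S)
    -- a finite component of the Auslander-Reiten quiver of the category of f.g. modules in `S`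
    (Γ : RelativeAR.ARComponent (RelativeAR.fgPart S))
    (hfinite : Γ.vertices.Finite)
    -- the almost split morphisms and sequences in `S ∩ mod R` at the modules in `Γ` exist
    (hΓ : RelativeAR.HaveARSequences Γ.modules (RelativeAR.fgPart S) (RelativeAR.fgPart S))
    (hgen : Γ.ContainsProjectiveGenerator)
    (hendo : ∀ M : ModuleCat.{u} Rᵐᵒᵖ, Γ.modules M → RelativeAR.IsEndofinite M)
    -- each Auslander-Reiten sequence in `Γ` is one in `S`
    (hseq : ∀ E : ShortComplex (ModuleCat.{u} Rᵐᵒᵖ),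
      RelativeAR.IsARSequence (RelativeAR.fgPart S) (RelativeAR.fgPart S) E →
      Γ.modules E.X₁ → Γ.modules E.X₃ → RelativeAR.IsARSequence (RelativeAR.fgPart S) S E)
    -- where no Auslander-Reiten sequence starts, the left almost split morphisms in `S ∩ mod R`
    -- are left almost split in `S`
    (hinj : ∀ (M B : ModuleCat.{u} Rᵐᵒᵖ) (f : M ⟶ B), Γ.modules M →
      RelativeAR.IsRelInjective (RelativeAR.fgPart S) M → RelativeAR.fgPart S B →
      RelativeAR.IsLeftAlmostSplit (RelativeAR.fgPart S) f → RelativeAR.IsLeftAlmostSplit S f) :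
    RelativeAR.HasARSequencesIn (RelativeAR.fgPart S) S ∧
    Γ.vertices = Set.univ ∧
    ∀ X : ModuleCat.{u} Rᵐᵒᵖ, S X →
      ∃ (ι : Type u) (M : ι → ModuleCat.{u} Rᵐᵒᵖ), (∀ i, Γ.modules (M i)) ∧
        Nonempty (X ≃ₗ[Rᵐᵒᵖ] DirectSum ι fun i => M i) := by
  have := hR.artinian_right
  have hiso : ∀ M N : ModuleCat.{u} Rᵐᵒᵖ, (M ≅ N) → Γ.modules M → Γ.modules N :=
    fun M N e => ARComponent.modules_of_iso hsummand e
  have hleft : ∀ M, Γ.modules M → ∃ (B : ModuleCat.{u} Rᵐᵒᵖ) (f : M ⟶ B), fgPart S B ∧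
      IsLeftAlmostSplit S f := by
    intro M hM
    by_cases hi : IsRelInjective (fgPart S) M
    · obtain ⟨B, f, hB, hf⟩ := hΓ.leftAlmostSplit M hM
      exact ⟨B, f, hB, hinj M B f hM hi hB hf⟩
    · obtain ⟨E, hE, ⟨e⟩⟩ := hΓ.starting M hM hi
      have h₁ := hiso _ _ e.symm hM
      have hE' := hseq E hE h₁ (ARComponent.modules_X₃ hsummand hE h₁)
      exact ⟨E.X₂, e.inv ≫ E.f, hE'.mem₂, hE'.left.of_iso e.symm⟩
  have hlas : ∀ M, Γ.modules M → ∃ (B : ModuleCat.{u} Rᵐᵒᵖ) (f : M ⟶ B),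
      IsFiniteSumOf Γ.modules B ∧ IsLeftAlmostSplit S f := by
    intro M hM
    obtain ⟨B, f, hB, hf⟩ := hleft M hM
    obtain ⟨B', f', hB', hf', hmin⟩ := hf.exists_minimal hsummand hB
    exact ⟨B', f', ARComponent.isFiniteSumOf_of_left hsummand hM hB' hf' hmin, hf'⟩
  obtain ⟨b, hb⟩ := ARComponent.exists_length_le hfinite
  have hdec := exists_indep_sSup_eq_top hiso (fun M hM => ⟨hM.1.2, hM.1.1.2⟩) hb hlas
    hgen.exists_notMem
  -- A decomposition of an indecomposable module into nonzero submodules has a single member, here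
  -- one from `Γ`.
  have hall : ∀ M, indec (fgPart S) M → Γ.modules M := by
    intro M hM
    obtain ⟨T, hT, hind, htop⟩ := hdec M hM.1.1
    obtain ⟨W, hW, ⟨e⟩⟩ := exists_iso_of_indep hM.2 hind htop fun W hW => by
      rintro rfl
      have := (hT _ hW).1.2.nontrivial
      exact not_subsingleton_iff_nontrivial.mpr this
        (inferInstanceAs (Subsingleton (⊥ : Submodule Rᵐᵒᵖ M)))
    exact hiso _ _ e (hT W hW)
  have hsums : ∀ X : ModuleCat.{u} Rᵐᵒᵖ, S X →
      ∃ (ι : Type u) (M : ι → ModuleCat.{u} Rᵐᵒᵖ), (∀ i, Γ.modules (M i)) ∧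
        Nonempty (X ≃ₗ[Rᵐᵒᵖ] DirectSum ι fun i => M i) := by
    intro X hX
    obtain ⟨T, hT, hind, htop⟩ := hdec X hX
    exact ⟨T, fun W => ModuleCat.of Rᵐᵒᵖ W, fun W => hT W W.2, exists_directSum_equiv hind htop⟩
  refine ⟨⟨fun M hM => hleft M (hall M hM), fun M hM => ?_, fun M hM hp => ?_, fun M hM hi => ?_⟩,
    ?_, hsums⟩
  · obtain ⟨B, g, hB, hg⟩ := hΓ.rightAlmostSplit M (hall M hM)
    refine ⟨B, g, hB, hg.of_directSum fun X hX => ?_⟩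
    obtain ⟨ι, N, hN, e⟩ := hsums X hX
    exact ⟨ι, N, fun i => (hN i).1.1, e⟩
  · obtain ⟨E, hE, e⟩ := hΓ.ending M (hall M hM) hp
    -- End terms of AR sequences are indecomposable, so by `hall` they lie in `Γ` and `hseq`
    -- applies.
    have h₁ := hall _ ⟨hE.mem₁, hE.left.indecomposable hsummand hE.mem₁⟩
    exact ⟨E, hseq E hE h₁ (ARComponent.modules_X₃ hsummand hE h₁), e⟩
  · obtain ⟨E, hE, e⟩ := hΓ.starting M (hall M hM) hi
    have h₁ := hall _ ⟨hE.mem₁, hE.left.indecomposable hsummand hE.mem₁⟩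
    exact ⟨E, hseq E hE h₁ (ARComponent.modules_X₃ hsummand hE h₁), e⟩
  · refine Set.eq_univ_of_forall fun v => ?_
    induction v using Quotient.inductionOn with
    | h M => exact (hall M.1 M.2).2
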